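/- Let $n\in\mathbb N$ and $T>0$. Equip $\mathbb R^n$ with the norm $\|x\|=\sum_j|x_j|$ and $\mathcal L(\mathbb R^n)$ with the induced operator norm, and let $G[0,T]$ be the Banach space of regulated functions $[0,T]\to\mathbb R^n$ (all one-sided limits exist) with the supremum norm. Integrals $\int_a^b DU(\tau,t)$ are Kurzweil integrals, i.e. limits, with respect to gauges, of the sums $\sum_j[U(\tau_j,t_j)-U(\tau_j,t_{j-1})]$ over tagged partitions. For a Banach space $Y$, an open set $\Omega\subset\mathbb R^n$, a nondecreasing $h:[0,T]\to\mathbb R$ and an increasing continuous $\omega:[0,\infty)\to[0,\infty)$ with $\omega(0)=0$, let $\mathcal F(\Omega\times[0,T],h,\omega;Y)$ be the set of all $F:\Omega\times[0,T]\to Y$ such that $$\|F(x,t_2)-F(x,t_1)\|\le|h(t_2)-h(t_1)|,\qquad \|F(x,t_2)-F(x,t_1)-F(y,t_2)+F(y,t_1)\|\le\omega(\|x-y\|)\,|h(t_2)-h(t_1)|$$ for all $x,y\in\Omega$ and $t_1,t_2\in[0,T]$. Let $\Omega\subset\mathbb R^n$ and $\Lambda\subset\mathbb R$ be open and let $F:\Lambda\times\Omega\times[0,T]\to\mathbb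 R^n$, $x_0\in G[0,T]$ and $\lambda_0\in\Lambda$. Assume: 1. there are $h,\omega$ as above, independent of $\lambda$, with $F(\lambda,\cdot,\cdot)\in\mathcal F(\Omega\times[0,T],h,\omega;\mathbb R^n)$ for all $\lambda\in\Lambda$; 2. for every $\lambda\in\Lambda$ the function $x_0$ is a solution of the periodic problem $\frac{dx}{d\tau}=DF(\lambda,x,t)$, $x(0)=x(T)$; that is, $x_0(s)\in\Omega$ and $x_0(s)=x_0(0)+\int_0^sDF(\lambda,x_0(\tau),t)$ for all $s\in[0,T]$, and $x_0(0)=x_0(T)$; 3. there is $\rho>0$ such that $x(t)\in\Omega$ for all $t\in[0,T]$ and all $x\in G[0,T]$ with $\|x-x_0\|_\infty\le\rho$; 4. for all $(\lambda,x,t)\in\Lambda\times\Omega\times[0,T]$ the Fréchet derivative $F'_x(\lambda,x,t)\in\mathcal L(\mathbb R^n)$ of $F(\lambda,\cdot,t)$ at $x$ exists, for fixed $(\lambda,t)$ it is continuous in $x\in\Omega$, and there are $\widetilde h,\widetilde\omega$ as above, independent of $\lambda$, with $F'_x(\lambda,\cdot,\cdot)\in\mathcal F(\Omega\times[0,T],\widetilde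 h,\widetilde\omega;\mathcal L(\mathbb R^n))$ for all $\lambda\in\Lambda$. Then exactly one of the following holds: (i) for every $q\in G[0,T]$ the equation $$z(s)-z(T)-\int_0^sD[F'_x(\lambda_0,x_0(\tau),t)\,z(\tau)]=q(s)\quad\text{for } s\in[0,T]$$ has a unique solution $z\in G[0,T]$; (ii) the homogeneous equation $$z(s)-z(T)-\int_0^sD[F'_x(\lambda_0,x_0(\tau),t)\,z(\tau)]=0\quad\text{for } s\in[0,T]$$ has a nontrivial solution $z\in G[0,T]$. Moreover, all these integrals exist for every $z\in G[0,T]$ and $s\in[0,T]$, and $z\mapsto\big(s\mapsto z(T)+\int_0^sD[F'_x(\lambda_0,x_0(\tau),t)\,z(\tau)]\big)$ defines a compact bounded linear operator on $G[0,T]$. -/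

import Mathlib

open Set Filter Topology
open scoped ENNReal

noncomputable section

/-- The space of real `n`-vectors with the norm `‖x‖ = ∑ j, |x j|`. -/
abbrev RVec (n : ℕ) : Type := PiLp 1 (fun _ : Fin n => ℝ)

/-- A function on `[a, b]` is regulated if all its one-sided limits exist. The filters are taken
inside `[a, b]`, so the left condition at `a` and the right condition at `b` are void. -/
def IsRegulated {a b : ℝ} {X : Type*} [TopologicalSpace X] (x : Icc a b → X) : Prop :=
  ∀ t : Icc a b, (∃ l : X, Tendsto x (𝓝[<] t) (𝓝 l)) ∧ (∃ r : X, Tendsto x (𝓝[>] t) (𝓝 r))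

section RegulatedSpace

variable {a b : ℝ} {X : Type*} [NormedAddCommGroup X]

theorem IsRegulated.exists_bound {x : Icc a b → X} (hx : IsRegulated x) :
    ∃ C : ℝ, ∀ t, ‖x t‖ ≤ C := by
  have key : ∃ C : ℝ, ∀ t ∈ (Set.univ : Set (Icc a b)), ‖x t‖ ≤ C := by
    refine isCompact_univ.induction_on (p := fun s => ∃ C : ℝ, ∀ t ∈ s, ‖x t‖ ≤ C)
      ⟨0, by simp⟩ ?_ ?_ ?_
    · rintro s t hst ⟨C, hC⟩
      exact ⟨C, fun u hu => hC u (hst hu)⟩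
    · rintro s t ⟨C, hC⟩ ⟨D, hD⟩
      refine ⟨max C D, fun u hu => ?_⟩
      rcases hu with hu | hu
      · exact (hC u hu).trans (le_max_left _ _)
      · exact (hD u hu).trans (le_max_right _ _)
    · intro t _
      obtain ⟨⟨l, hl⟩, ⟨r, hr⟩⟩ := hx t
      have e1 : ∀ᶠ u in 𝓝[<] t, ‖x u‖ ≤ ‖l‖ + 1 :=
        (hl.norm.eventually (gt_mem_nhds (lt_add_one ‖l‖))).mono fun _ h => h.le
      have e2 : ∀ᶠ u in 𝓝[>] t, ‖x u‖ ≤ ‖r‖ + 1 :=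
        (hr.norm.eventually (gt_mem_nhds (lt_add_one ‖r‖))).mono fun _ h => h.le
      rw [eventually_nhdsWithin_iff] at e1 e2
      refine ⟨{u | ‖x u‖ ≤ max (max (‖l‖ + 1) (‖r‖ + 1)) ‖x t‖}, ?_, _, fun u hu => hu⟩
      rw [nhdsWithin_univ]
      filter_upwards [e1, e2] with u h1 h2
      rcases lt_trichotomy u t with h | h | h
      · exact (h1 h).trans ((le_max_left _ _).trans (le_max_left _ _))
      · exact h ▸ le_max_right _ _
      · exact (h2 h).trans ((le_max_right _ _).trans (le_max_left _ _))
  exact key.imp fun C hC t => hC t (mem_univ t)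

theorem IsRegulated.memℓp {x : Icc a b → X} (hx : IsRegulated x) :
    Memℓp (E := fun _ : Icc a b => X) x ∞ := by
  obtain ⟨C, hC⟩ := hx.exists_bound
  refine memℓp_infty ⟨C, ?_⟩
  rintro _ ⟨t, rfl⟩
  exact hC t

variable (a b X) [NormedSpace ℝ X]

/-- The regulated functions as a subspace of the space of all bounded functions `[a, b] → X` with
the supremum norm. -/
def regulatedSubmodule : Submodule ℝ (lp (fun _ : Icc a b => X) ∞) where
  carrier := {x | IsRegulated (fun t => x t)}
  zero_mem' := fun _ => ⟨⟨0, tendsto_const_nhds⟩, ⟨0, tendsto_const_nhds⟩⟩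
  add_mem' := by
    intro x y hx hy t
    obtain ⟨⟨l, hl⟩, ⟨r, hr⟩⟩ := hx t
    obtain ⟨⟨l', hl'⟩, ⟨r', hr'⟩⟩ := hy t
    exact ⟨⟨l + l', hl.add hl'⟩, ⟨r + r', hr.add hr'⟩⟩
  smul_mem' := by
    intro c x hx t
    obtain ⟨⟨l, hl⟩, ⟨r, hr⟩⟩ := hx t
    exact ⟨⟨c • l, hl.const_smul c⟩, ⟨c • r, hr.const_smul c⟩⟩

/-- The space `G([a, b]; X)` of regulated functions `[a, b] → X` with the supremum norm. -/
abbrev RegulatedSpace : Type _ := regulatedSubmodule a b X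

variable {a b X}

/-- Every regulated function is an element of `G([a, b]; X)`. -/
def RegulatedSpace.mk (x : Icc a b → X) (hx : IsRegulated x) : RegulatedSpace a b X :=
  ⟨⟨x, hx.memℓp⟩, hx⟩

/-- The value `x(t)`, for `t ∈ [a, b]`, of a regulated function `x` (zero for other `t`). -/
def RegulatedSpace.eval (x : RegulatedSpace a b X) (t : ℝ) : X :=
  open Classical in if h : t ∈ Icc a b then (x : lp (fun _ : Icc a b => X) ∞) ⟨t, h⟩ else 0

end RegulatedSpace

/-- A tagged partition of `[a, b]`: division points `a = t 0 ≤ t 1 ≤ ⋯ ≤ t ν = b` and tags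
`τ j ∈ [t j, t (j + 1)]` for `j < ν`. -/
structure TaggedPartition (a b : ℝ) where
  ν : ℕ
  t : ℕ → ℝ
  τ : ℕ → ℝ
  t_zero : t 0 = a
  t_last : t ν = b
  tag_mem : ∀ j < ν, t j ≤ τ j ∧ τ j ≤ t (j + 1)

/-- Fineness of a tagged partition with respect to a gauge `δ`. -/
def TaggedPartition.IsFine {a b : ℝ} (P : TaggedPartition a b) (δ : ℝ → ℝ) : Prop :=
  ∀ j < P.ν, Icc (P.t j) (P.t (j + 1)) ⊆ Ioo (P.τ j - δ (P.τ j)) (P.τ j + δ (P.τ j))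

/-- The integral sum of `U` with respect to a tagged partition. -/
def TaggedPartition.sum {a b : ℝ} {X : Type*} [AddCommGroup X] (P : TaggedPartition a b)
    (U : ℝ → ℝ → X) : X :=
  ∑ j ∈ Finset.range P.ν, (U (P.τ j) (P.t (j + 1)) - U (P.τ j) (P.t j))

/-- For `a ≤ b`: the Kurzweil integral `∫_a^b DU(τ, t)` exists and equals `I`. Only the values of
`U` on `[a, b] × [a, b]` matter, and for `a = b` the integral is `0`. -/
def HasKurzweilIntegral {X : Type*} [NormedAddCommGroup X] (U : ℝ → ℝ → X) (a b : ℝ) (I : X) :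
    Prop :=
  ∀ ε > 0, ∃ δ : ℝ → ℝ, (∀ τ, 0 < δ τ) ∧
    ∀ P : TaggedPartition a b, P.IsFine δ → ‖P.sum U - I‖ < ε

/-- The class `𝓕(Ω × [a, b], h, ω; Y)` of functions `F : Ω × [a, b] → Y`, including the
requirements on `h` and `ω`. -/
structure KurzweilClass {X Y : Type*} [NormedAddCommGroup X] [NormedAddCommGroup Y]
    (Ω : Set X) (a b : ℝ) (h ω : ℝ → ℝ) (F : X → ℝ → Y) : Prop where
  h_mono : MonotoneOn h (Icc a b)
  ω_strictMono : StrictMonoOn ω (Ici 0)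
  ω_cont : ContinuousOn ω (Ici 0)
  ω_zero : ω 0 = 0
  bound : ∀ x ∈ Ω, ∀ t₁ ∈ Icc a b, ∀ t₂ ∈ Icc a b, ‖F x t₂ - F x t₁‖ ≤ |h t₂ - h t₁|
  bound_diff : ∀ x ∈ Ω, ∀ y ∈ Ω, ∀ t₁ ∈ Icc a b, ∀ t₂ ∈ Icc a b,
    ‖F x t₂ - F x t₁ - F y t₂ + F y t₁‖ ≤ ω ‖x - y‖ * |h t₂ - h t₁|

/-- `x` is a solution on `[0, T]` of the periodic problem `dx/dτ = DF(x, t)`, `x(0) = x(T)`. -/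
def IsPeriodicSolution {n : ℕ} {T : ℝ} (Ω : Set (RVec n)) (F : RVec n → ℝ → RVec n)
    (x : RegulatedSpace 0 T (RVec n)) : Prop :=
  (∀ s ∈ Icc 0 T, x.eval s ∈ Ω ∧
    HasKurzweilIntegral (fun τ t => F (x.eval τ) t) 0 s (x.eval s - x.eval 0)) ∧
  x.eval 0 = x.eval T

/-- `z` is a solution of `z(s) - z(T) - ∫_0^s D[A(x(τ), t) z(τ)] = q(s)` for `s ∈ [0, T]`,
where the existence of the integral is part of the assertion. -/
def SolvesLinearized {n : ℕ} {T : ℝ} (A : RVec n → ℝ → (RVec n →L[ℝ] RVec n))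
    (x z q : RegulatedSpace 0 T (RVec n)) : Prop :=
  ∀ s ∈ Icc 0 T, ∃ J : RVec n,
    HasKurzweilIntegral (fun τ t => A (x.eval τ) t (z.eval τ)) 0 s J ∧
    z.eval s - z.eval T - J = q.eval s

end

/-!
With `K z (s) = z(T) + ∫_0^s D[F'_x(λ₀, x₀(τ), t) z(τ)]` the equation reads `z - K z = q`, so the
dichotomy is the Fredholm alternative for a compact operator on the Banach space of regulated
functions.

The integrals exist because a regulated function is uniformly close to one that is constant on each
of finitely many intervals. This makes the integrand `U(τ, t)` close to a finite sum of integrands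
`f(t)` cut off in `τ` to an interval, the difference of two half-lines. For a half-line the integral
sums telescope to `f(t) - f(0)`, where the division point `t` tends to the end of the half-line from
one side as the partition gets fine.

The operator `K` is compact because the increments of `K z` are at most `‖z‖` times those of one
monotone function `h`. On a finite set whose image under `h` is a fine net of the range of `h`, the
values of `K z` determine `K z` up to a small error in the supremum norm, and for `‖z‖ ≤ 1` these
values stay in a bounded set of a finite-dimensional space.
-/

section Approximation

variable {α β γ : Type*} [PseudoMetricSpace α] [PseudoMetricSpace β]

theorem exists_tendsto_of_dist_le_mul [CompleteSpace α] [Nonempty α] {l : Filter γ} {f : γ → α}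
    {g : γ → β} {C : ℝ} {y : β} (hfg : ∀ s t, dist (f s) (f t) ≤ C * dist (g s) (g t))
    (hg : Tendsto g l (𝓝 y)) : ∃ x, Tendsto f l (𝓝 x) := by
  rcases l.eq_or_neBot with rfl | _
  · exact ⟨Classical.arbitrary α, tendsto_bot⟩
  have hdist : Tendsto (fun p : γ × γ => C * dist (g p.1) (g p.2)) (l ×ˢ l) (𝓝 0) := by
    simpa using ((hg.comp tendsto_fst).dist (hg.comp tendsto_snd)).const_mul C
  refine cauchy_map_iff_exists_tendsto.1 (cauchy_map_iff'.2 ?_)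
  exact tendsto_uniformity_iff_dist_tendsto_zero.2
    (squeeze_zero (fun _ => dist_nonneg) (fun p => hfg p.1 p.2) hdist)

theorem exists_tendsto_of_forall_exists_dist_le [CompleteSpace α] {l : Filter γ} {f : γ → α}
    (hf : ∀ ε > 0, ∃ g : γ → α, (∀ s, dist (f s) (g s) ≤ ε) ∧ ∃ x, Tendsto g l (𝓝 x)) :
    ∃ x, Tendsto f l (𝓝 x) := by
  rcases l.eq_or_neBot with rfl | _
  · obtain ⟨-, -, x, -⟩ := hf 1 one_pos
    exact ⟨x, tendsto_bot⟩
  refine cauchy_map_iff_exists_tendsto.1 (Metric.cauchy_iff.2 ⟨inferInstance, fun ε hε => ?_⟩)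
  obtain ⟨g, hfg, x, hg⟩ := hf (ε / 4) (by positivity)
  have hnear : ∀ᶠ s in l, dist (f s) x < ε / 2 := by
    filter_upwards [hg (Metric.ball_mem_nhds x (show 0 < ε / 4 by positivity))] with s hs
    rw [mem_preimage, Metric.mem_ball] at hs
    linarith [dist_triangle (f s) (g s) x, hfg s]
  refine ⟨_, image_mem_map hnear, ?_⟩
  rintro _ ⟨s, hs, rfl⟩ _ ⟨t, ht, rfl⟩
  rw [mem_ofPred_eq] at hs ht
  linarith [dist_triangle_right (f s) (f t) x]

theorem exists_finite_subset_dist_image_lt {f : γ → α} {s : Set γ}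
    (hs : TotallyBounded (f '' s)) {ε : ℝ} (hε : 0 < ε) :
    ∃ t ⊆ s, t.Finite ∧ ∀ x ∈ s, ∃ y ∈ t, dist (f x) (f y) < ε := by
  obtain ⟨u, hus, hu, hcover⟩ := Metric.finite_approx_of_totallyBounded hs ε hε
  obtain ⟨t, hts, ht, rfl⟩ := exists_subset_image_finite_and.1 ⟨u, hus, hu, rfl⟩
  refine ⟨t, hts, ht, fun x hx => ?_⟩
  simpa only [biUnion_image, mem_iUnion, Metric.mem_ball, exists_prop] using
    hcover (mem_image_of_mem f hx)

end Approximation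

theorem eq_Iio_or_eq_Iic_of_isLowerSet {α : Type*} [LinearOrder α] {D : Set α} {c : α}
    (hD : IsLowerSet D) (hc : IsLUB D c) : D = Iio c ∨ D = Iic c := by
  by_cases hcD : c ∈ D
  · exact Or.inr (Subset.antisymm hc.1 fun x hx => hD hx hcD)
  · refine Or.inl (Subset.antisymm (fun x hx => (hc.1 hx).lt_of_ne fun h => hcD (h ▸ hx)) ?_)
    intro x hx
    obtain ⟨y, hyD, hxy⟩ := (lt_isLUB_iff hc).1 hx
    exact hD hxy.le hyD

theorem eq_of_sign_sub_eq_of_mem_uIcc {u v e : ℝ} (he : e ∈ uIcc u v)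
    (huv : SignType.sign (u - e) = SignType.sign (v - e)) : u = v := by
  rcases lt_trichotomy u e with hu | rfl | hu
  · have hv : v < e := by
      rwa [sign_neg (sub_neg.2 hu), eq_comm, sign_eq_neg_one_iff, sub_neg] at huv
    exact absurd he.2 (max_lt hu hv).not_ge
  · rwa [sub_self, sign_zero, eq_comm, sign_eq_zero_iff, sub_eq_zero, eq_comm] at huv
  · have hv : e < v := by
      rwa [sign_pos (sub_pos.2 hu), eq_comm, sign_eq_one_iff, sub_pos] at huv
    exact absurd he.1 (lt_min hu hv).not_ge

theorem exists_finite_subset_forall_mul_abs_sub_le {a b : ℝ} {h : ℝ → ℝ}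
    (hh : MonotoneOn h (Icc a b)) (C : ℝ) {ε : ℝ} (hε : 0 < ε) :
    ∃ N ⊆ Icc a b, N.Finite ∧ ∀ t ∈ Icc a b, ∃ s ∈ N, C * |h t - h s| ≤ ε := by
  have hrange : TotallyBounded (h '' Icc a b) := (totallyBounded_Icc (h a) (h b)).subset
    hh.image_Icc_subset
  obtain ⟨N, hN, hNfin, hnet⟩ := exists_finite_subset_dist_image_lt hrange
    (show 0 < ε / (|C| + 1) by positivity)
  refine ⟨N, hN, hNfin, fun t ht => ?_⟩
  obtain ⟨s, hsN, hts⟩ := hnet t ht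
  refine ⟨s, hsN, ?_⟩
  calc C * |h t - h s| ≤ (|C| + 1) * (ε / (|C| + 1)) := by
        gcongr
        exacts [(le_abs_self C).trans (le_add_of_nonneg_right zero_le_one), hts.le]
    _ = ε := by field_simp

namespace TaggedPartition

variable {a b c : ℝ}

theorem t_le_succ (P : TaggedPartition a b) {j : ℕ} (hj : j < P.ν) : P.t j ≤ P.t (j + 1) :=
  (P.tag_mem j hj).1.trans (P.tag_mem j hj).2

theorem t_mono (P : TaggedPartition a b) {i j : ℕ} (hij : i ≤ j) (hj : j ≤ P.ν) :
    P.t i ≤ P.t j := by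
  induction j, hij using Nat.le_induction with
  | base => exact le_rfl
  | succ j _ ih => exact (ih (by omega)).trans (P.t_le_succ hj)

theorem t_mem (P : TaggedPartition a b) {j : ℕ} (hj : j ≤ P.ν) : P.t j ∈ Icc a b :=
  ⟨P.t_zero.ge.trans (P.t_mono j.zero_le hj), (P.t_mono hj le_rfl).trans P.t_last.le⟩

theorem τ_mem (P : TaggedPartition a b) {j : ℕ} (hj : j < P.ν) : P.τ j ∈ Icc a b :=
  ⟨(P.t_mem hj.le).1.trans (P.tag_mem j hj).1, (P.tag_mem j hj).2.trans (P.t_mem hj).2⟩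

theorem τ_mono (P : TaggedPartition a b) {i j : ℕ} (hij : i ≤ j) (hj : j < P.ν) :
    P.τ i ≤ P.τ j := by
  rcases hij.eq_or_lt with rfl | hlt
  · exact le_rfl
  · calc P.τ i ≤ P.t (i + 1) := (P.tag_mem i (hlt.trans hj)).2
      _ ≤ P.t j := P.t_mono hlt hj.le
      _ ≤ P.τ j := (P.tag_mem j hj).1

/-! ### Cousin's lemma -/

/-- The tagged partition of `[a, a]` without intervals. -/
def nil (a : ℝ) : TaggedPartition a a where
  ν := 0
  t _ := a
  τ _ := a
  t_zero := rfl
  t_last := rfl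
  tag_mem _ h := absurd h (Nat.not_lt_zero _)

/-- The tagged partition of `[a, b]` consisting of the single interval `[a, b]` with tag `s`. -/
def single {s : ℝ} (has : a ≤ s) (hsb : s ≤ b) : TaggedPartition a b where
  ν := 1
  t j := if j = 0 then a else b
  τ _ := s
  t_zero := by simp
  t_last := by simp
  tag_mem j hj := by simpa [Nat.lt_one_iff.1 hj] using ⟨has, hsb⟩

/-- The concatenation of a tagged partition of `[a, b]` and one of `[b, c]`. -/
def append (P : TaggedPartition a b) (Q : TaggedPartition b c) : TaggedPartition a c where
  ν := P.ν + Q.ν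
  t j := if j ≤ P.ν then P.t j else Q.t (j - P.ν)
  τ j := if j < P.ν then P.τ j else Q.τ (j - P.ν)
  t_zero := by simp [P.t_zero]
  t_last := by
    rcases Nat.eq_zero_or_pos Q.ν with h | h
    · have hbc : b = c := by simpa only [h, Q.t_zero] using Q.t_last
      simp [h, P.t_last, hbc]
    · rw [if_neg (by omega), Nat.add_sub_cancel_left, Q.t_last]
  tag_mem j hj := by
    rcases lt_trichotomy j P.ν with h | rfl | h
    · simpa [h, h.le, Nat.succ_le_of_lt h] using P.tag_mem j h
    · simpa [P.t_last, Q.t_zero] using Q.tag_mem 0 (by omega)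
    · rw [if_neg (by omega), if_neg (by omega), if_neg (by omega), Nat.succ_sub h.le]
      exact Q.tag_mem (j - P.ν) (by omega)

section Append

variable (P : TaggedPartition a b) (Q : TaggedPartition b c)

theorem ν_append : (P.append Q).ν = P.ν + Q.ν := rfl

theorem t_append_left {j : ℕ} (hj : j ≤ P.ν) : (P.append Q).t j = P.t j := if_pos hj

theorem τ_append_left {j : ℕ} (hj : j < P.ν) : (P.append Q).τ j = P.τ j := if_pos hj

theorem t_append_right (j : ℕ) : (P.append Q).t (P.ν + j) = Q.t j := by
  rcases Nat.eq_zero_or_pos j with rfl | hj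
  · simp [append, P.t_last, Q.t_zero]
  · simp [append, hj.ne']

theorem τ_append_right (j : ℕ) : (P.append Q).τ (P.ν + j) = Q.τ j := by
  simp [append]

end Append

variable {δ δ' : ℝ → ℝ}

theorem IsFine.mono (h : ∀ τ, δ τ ≤ δ' τ) {P : TaggedPartition a b} (hP : P.IsFine δ) :
    P.IsFine δ' := fun j hj =>
  (hP j hj).trans (Ioo_subset_Ioo (by linarith [h (P.τ j)]) (by linarith [h (P.τ j)]))

theorem IsFine.append {P : TaggedPartition a b} {Q : TaggedPartition b c} (hP : P.IsFine δ)
    (hQ : Q.IsFine δ) : (P.append Q).IsFine δ := by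
  intro j hj
  rcases lt_or_ge j P.ν with h | h
  · rw [t_append_left P Q h.le, t_append_left P Q h, τ_append_left P Q h]
    exact hP j h
  · obtain ⟨k, rfl⟩ := Nat.exists_eq_add_of_le h
    rw [add_assoc, t_append_right, t_append_right, τ_append_right]
    exact hQ k (by simpa only [ν_append, Nat.add_lt_add_iff_left] using hj)

theorem isFine_nil : (nil a).IsFine δ := fun _ h => absurd h (Nat.not_lt_zero _)

theorem isFine_single {s : ℝ} (has : a ≤ s) (hsb : s ≤ b) (ha : s - δ s < a) (hb : b < s + δ s) :
    (single has hsb).IsFine δ := by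
  intro j hj
  obtain rfl : j = 0 := Nat.lt_one_iff.1 hj
  simpa [single] using Icc_subset_Ioo ha hb

theorem exists_isFine (hδ : ∀ τ, 0 < δ τ) (hab : a ≤ b) :
    ∃ P : TaggedPartition a b, P.IsFine δ := by
  let S : Set ℝ := {c | c ∈ Icc a b ∧ ∃ P : TaggedPartition a c, P.IsFine δ}
  have haS : a ∈ S := ⟨left_mem_Icc.2 hab, nil a, isFine_nil⟩
  have hbdd : BddAbove S := ⟨b, fun x hx => hx.1.2⟩
  let c := sSup S
  have hac : a ≤ c := le_csSup hbdd haS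
  have hcb : c ≤ b := csSup_le ⟨a, haS⟩ fun x hx => hx.1.2
  obtain ⟨d, ⟨hd, P, hP⟩, hcd⟩ := exists_lt_of_lt_csSup ⟨a, haS⟩ (sub_lt_self c (hδ c))
  have hdc : d ≤ c := le_csSup hbdd ⟨hd, P, hP⟩
  have hextend : ∀ e ∈ Icc c b, e < c + δ c → e ∈ S := fun e he hlt =>
    ⟨⟨hac.trans he.1, he.2⟩, P.append (single hdc he.1),
      hP.append (isFine_single hdc he.1 hcd hlt)⟩
  suffices hbc : b ≤ c from (hextend b ⟨hcb, le_rfl⟩ (hbc.trans_lt (by linarith [hδ c]))).2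
  by_contra! hlt
  have hmem : min b (c + δ c / 2) ∈ S :=
    hextend _ ⟨le_min hcb (by linarith [hδ c]), min_le_left _ _⟩
      ((min_le_right _ _).trans_lt (by linarith [hδ c]))
  exact (le_csSup hbdd hmem).not_gt (lt_min hlt (by linarith [hδ c]))

/-- The filter of tagged partitions of `[a, b]` generated by the sets of `δ`-fine ones; the
Kurzweil integral is the limit of the integral sums along it. -/
def fineFilter (a b : ℝ) : Filter (TaggedPartition a b) :=
  ⨅ δ : {δ : ℝ → ℝ // ∀ τ, 0 < δ τ}, 𝓟 {P | P.IsFine δ.1}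

theorem hasBasis_fineFilter (a b : ℝ) : (fineFilter a b).HasBasis (fun _ => True)
    fun δ : {δ : ℝ → ℝ // ∀ τ, 0 < δ τ} => {P | P.IsFine δ.1} := by
  have : Nonempty {δ : ℝ → ℝ // ∀ τ, 0 < δ τ} := ⟨⟨fun _ => 1, fun _ => one_pos⟩⟩
  refine hasBasis_iInf_principal ?_
  rintro ⟨δ, hδ⟩ ⟨δ', hδ'⟩
  exact ⟨⟨fun τ => min (δ τ) (δ' τ), fun τ => lt_min (hδ τ) (hδ' τ)⟩,
    fun P => IsFine.mono fun τ => min_le_left _ _, fun P => IsFine.mono fun τ => min_le_right _ _⟩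

theorem eventually_isFine (hδ : ∀ τ, 0 < δ τ) : ∀ᶠ P in fineFilter a b, P.IsFine δ :=
  (hasBasis_fineFilter a b).eventually_iff.2 ⟨⟨δ, hδ⟩, trivial, fun _ h => h⟩

theorem tendsto_append : Tendsto (fun p : TaggedPartition a b × TaggedPartition b c =>
    p.1.append p.2) (fineFilter a b ×ˢ fineFilter b c) (fineFilter a c) :=
  (hasBasis_fineFilter a c).tendsto_right_iff.2 fun δ _ =>
    ((eventually_isFine δ.2).prod_mk (eventually_isFine δ.2)).mono fun _ h => h.1.append h.2

theorem fineFilter_neBot (hab : a ≤ b) : (fineFilter a b).NeBot :=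
  (hasBasis_fineFilter a b).neBot_iff.2 fun {δ} _ => exists_isFine δ.2 hab

/-! ### Integral sums -/

section Sum

variable {X : Type*} [AddCommGroup X] (P : TaggedPartition a b)

/-- The integral sum as a homomorphism in the integrand. -/
def sumHom (X : Type*) [AddCommGroup X] : (ℝ → ℝ → X) →+ X :=
  AddMonoidHom.mk' P.sum fun U V => by
    simp only [sum, Pi.add_apply, add_sub_add_comm, Finset.sum_add_distrib]

theorem coe_sumHom : ⇑(P.sumHom X) = P.sum := rfl

theorem sum_smul [Module ℝ X] (r : ℝ) (U : ℝ → ℝ → X) : P.sum (r • U) = r • P.sum U := by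
  simp only [sum, Pi.smul_apply, Finset.smul_sum, smul_sub]

theorem sum_const (f : ℝ → X) : P.sum (fun _ => f) = f b - f a := by
  rw [sum, Finset.sum_range_sub (fun j => f (P.t j)), P.t_last, P.t_zero]

theorem sum_congr {U V : ℝ → ℝ → X} (h : ∀ τ ∈ Icc a b, U τ = V τ) : P.sum U = P.sum V :=
  Finset.sum_congr rfl fun _ hj => by rw [h _ (P.τ_mem (Finset.mem_range.1 hj))]

theorem sum_append (Q : TaggedPartition b c) (U : ℝ → ℝ → X) :
    (P.append Q).sum U = P.sum U + Q.sum U := by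
  rw [sum, ν_append, Finset.sum_range_add]
  congr 1
  · refine Finset.sum_congr rfl fun j hj => ?_
    have hj : j < P.ν := Finset.mem_range.1 hj
    rw [t_append_left P Q hj.le, t_append_left P Q hj, τ_append_left P Q hj]
  · refine Finset.sum_congr rfl fun j _ => ?_
    rw [add_assoc, t_append_right, t_append_right, τ_append_right]

end Sum

theorem norm_sum_le {X : Type*} [NormedAddCommGroup X] (P : TaggedPartition a b)
    {U : ℝ → ℝ → X} {h : ℝ → ℝ} {C : ℝ} (hh : MonotoneOn h (Icc a b))
    (hU : ∀ τ ∈ Icc a b, ∀ s ∈ Icc a b, ∀ t ∈ Icc a b, ‖U τ t - U τ s‖ ≤ C * |h t - h s|) :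
    ‖P.sum U‖ ≤ C * (h b - h a) := by
  calc ‖P.sum U‖ ≤ ∑ j ∈ Finset.range P.ν, C * (h (P.t (j + 1)) - h (P.t j)) := by
        refine norm_sum_le_of_le _ fun j hj => ?_
        have hj : j < P.ν := Finset.mem_range.1 hj
        have hmono := hh (P.t_mem hj.le) (P.t_mem hj) (P.t_le_succ hj)
        rw [← abs_of_nonneg (sub_nonneg.2 hmono)]
        exact hU _ (P.τ_mem hj) _ (P.t_mem hj.le) _ (P.t_mem hj)
    _ = C * (h b - h a) := by
        rw [← Finset.mul_sum, Finset.sum_range_sub (fun j => h (P.t j)), P.t_last, P.t_zero]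

/-! ### Integrands cut off to a half-line -/

/-- The number of leading tags in `D`. For a lower set `D` these are all the tags in `D`. -/
noncomputable def exitIndex (P : TaggedPartition a b) (D : Set ℝ) : ℕ :=
  sInf {j | j < P.ν → P.τ j ∉ D}

section ExitIndex

variable (P : TaggedPartition a b) {D : Set ℝ}

theorem exitIndex_le : P.exitIndex D ≤ P.ν := Nat.sInf_le fun h => absurd h (lt_irrefl _)

theorem τ_mem_of_lt_exitIndex {j : ℕ} (hj : j < P.exitIndex D) : P.τ j ∈ D := by
  simpa [hj.trans_le P.exitIndex_le] using Nat.notMem_of_lt_sInf hj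

theorem τ_exitIndex_notMem (h : P.exitIndex D < P.ν) : P.τ (P.exitIndex D) ∉ D :=
  Nat.sInf_mem (s := {j | j < P.ν → P.τ j ∉ D}) ⟨P.ν, fun h => absurd h (lt_irrefl _)⟩ h

theorem sum_indicator {X : Type*} [AddCommGroup X] (hD : IsLowerSet D) (f : ℝ → X) :
    P.sum (D.indicator fun _ => f) = f (P.t (P.exitIndex D)) - f a := by
  have hvanish : ∀ j ∈ Finset.Ico (P.exitIndex D) P.ν, P.τ j ∉ D := fun j hj hjD => by
    obtain ⟨hle, hlt⟩ := Finset.mem_Ico.1 hj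
    exact P.τ_exitIndex_notMem (hle.trans_lt hlt) (hD (P.τ_mono hle hlt) hjD)
  calc P.sum (D.indicator fun _ => f)
      = ∑ j ∈ Finset.range (P.exitIndex D), (f (P.t (j + 1)) - f (P.t j)) := by
        rw [sum, ← Finset.sum_range_add_sum_Ico _ P.exitIndex_le,
          Finset.sum_eq_zero (s := Finset.Ico _ _) fun j hj => by simp [hvanish j hj], add_zero]
        refine Finset.sum_congr rfl fun j hj => ?_
        rw [indicator_of_mem (P.τ_mem_of_lt_exitIndex (Finset.mem_range.1 hj))]
    _ = f (P.t (P.exitIndex D)) - f a := by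
        rw [Finset.sum_range_sub (fun j => f (P.t j)), P.t_zero]

end ExitIndex

-- The gauge `|τ - c|` at `τ ≠ c` forces every interval that contains `c` to have the tag `c`.
theorem eventually_tag_eq {s : Set ℝ} (hs : s ∈ 𝓝 c) : ∀ᶠ P in fineFilter a b,
    ∀ j < P.ν, c ∈ Icc (P.t j) (P.t (j + 1)) → P.τ j = c ∧ Icc (P.t j) (P.t (j + 1)) ⊆ s := by
  obtain ⟨d, hd, hds⟩ := Metric.mem_nhds_iff.1 hs
  have hpos : ∀ τ : ℝ, 0 < if τ = c then d else |τ - c| := fun τ => by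
    split_ifs with h
    exacts [hd, abs_pos.2 (sub_ne_zero.2 h)]
  filter_upwards [eventually_isFine hpos] with P hP j hj hc
  have htag : P.τ j = c := by
    by_contra hne
    have hmem := hP j hj hc
    simp only [if_neg hne] at hmem
    rw [← Real.ball_eq_Ioo, Metric.mem_ball, dist_comm, Real.dist_eq] at hmem
    exact hmem.false
  refine ⟨htag, (hP j hj).trans ?_⟩
  simpa only [htag, if_true, ← Real.ball_eq_Ioo] using hds

theorem tendsto_t_exitIndex_Iic (hc : c ∈ Ico a b) :
    Tendsto (fun P : TaggedPartition a b => P.t (P.exitIndex (Iic c))) (fineFilter a b)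
      (𝓝[>] c) := by
  have hnear : ∀ s ∈ 𝓝 c, ∀ᶠ P in fineFilter a b, P.t (P.exitIndex (Iic c)) ∈ s ∩ Ioi c := by
    intro s hs
    filter_upwards [eventually_tag_eq hs] with P hP
    have hgt : c < P.t (P.exitIndex (Iic c)) := by
      by_contra! hle
      have hlt : P.exitIndex (Iic c) < P.ν := P.exitIndex_le.lt_of_ne fun h =>
        (hle.trans_lt hc.2).ne (by rw [h, P.t_last])
      have hτ : c < P.τ (P.exitIndex (Iic c)) := not_le.1 (P.τ_exitIndex_notMem hlt)
      exact hτ.ne' (hP _ hlt ⟨hle, hτ.le.trans (P.tag_mem _ hlt).2⟩).1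
    obtain ⟨k, hk⟩ : ∃ k, P.exitIndex (Iic c) = k + 1 :=
      Nat.exists_eq_succ_of_ne_zero fun h => hgt.not_ge (by rw [h, P.t_zero]; exact hc.1)
    have hkν : k < P.ν := by have := P.exitIndex_le (D := Iic c); omega
    have hτ : P.τ k ≤ c := P.τ_mem_of_lt_exitIndex (D := Iic c) (by omega)
    rw [hk] at hgt ⊢
    exact ⟨(hP k hkν ⟨(P.tag_mem k hkν).1.trans hτ, hgt.le⟩).2
      (right_mem_Icc.2 (P.t_le_succ hkν)), hgt⟩
  exact tendsto_nhdsWithin_iff.2 ⟨fun s hs => (hnear s hs).mono fun _ h => h.1,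
    (hnear univ univ_mem).mono fun _ h => h.2⟩

theorem tendsto_t_exitIndex_Iio (hc : c ∈ Ioc a b) :
    Tendsto (fun P : TaggedPartition a b => P.t (P.exitIndex (Iio c))) (fineFilter a b)
      (𝓝[<] c) := by
  have hnear : ∀ s ∈ 𝓝 c, ∀ᶠ P in fineFilter a b, P.t (P.exitIndex (Iio c)) ∈ s ∩ Iio c := by
    intro s hs
    filter_upwards [eventually_tag_eq hs] with P hP
    have hlt : P.t (P.exitIndex (Iio c)) < c := by
      by_contra! hge
      obtain ⟨k, hk⟩ : ∃ k, P.exitIndex (Iio c) = k + 1 :=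
        Nat.exists_eq_succ_of_ne_zero fun h => hc.1.not_ge (by rwa [h, P.t_zero] at hge)
      have hkν : k < P.ν := by have := P.exitIndex_le (D := Iio c); omega
      have hτ : P.τ k < c := P.τ_mem_of_lt_exitIndex (D := Iio c) (by omega)
      rw [hk] at hge
      exact hτ.ne (hP k hkν ⟨(P.tag_mem k hkν).1.trans hτ.le, hge⟩).1
    have hν : P.exitIndex (Iio c) < P.ν := P.exitIndex_le.lt_of_ne fun h =>
      hlt.not_ge (by rw [h, P.t_last]; exact hc.2)
    have hτ : c ≤ P.τ (P.exitIndex (Iio c)) := not_lt.1 (P.τ_exitIndex_notMem hν)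
    exact ⟨(hP _ hν ⟨hlt.le, hτ.trans (P.tag_mem _ hν).2⟩).2
      (left_mem_Icc.2 (P.t_le_succ hν)), hlt⟩
  exact tendsto_nhdsWithin_iff.2 ⟨fun s hs => (hnear s hs).mono fun _ h => h.1,
    (hnear univ univ_mem).mono fun _ h => h.2⟩

end TaggedPartition

/-! ### Regulated functions -/

section IsRegulated

variable {a b c : ℝ} {X : Type*}

theorem IsRegulated.exists_tendsto_nhdsGT [TopologicalSpace X] {f : ℝ → X}
    (hf : IsRegulated fun t : Icc a b => f t) (hc : c ∈ Ico a b) :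
    ∃ r, Tendsto f (𝓝[>] c) (𝓝 r) := by
  obtain ⟨r, hr⟩ := (hf ⟨c, Ico_subset_Icc_self hc⟩).2
  refine ⟨r, ?_⟩
  rwa [← nhdsWithin_Ioc_eq_nhdsGT hc.2, ← image_subtype_val_Icc_Ioi ⟨c, Ico_subset_Icc_self hc⟩,
    ← IsEmbedding.subtypeVal.map_nhdsWithin_eq (Ioi _) ⟨c, _⟩, tendsto_map'_iff]

theorem IsRegulated.exists_tendsto_nhdsLT [TopologicalSpace X] {f : ℝ → X}
    (hf : IsRegulated fun t : Icc a b => f t) (hc : c ∈ Ioc a b) :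
    ∃ l, Tendsto f (𝓝[<] c) (𝓝 l) := by
  obtain ⟨l, hl⟩ := (hf ⟨c, Ioc_subset_Icc_self hc⟩).1
  refine ⟨l, ?_⟩
  rwa [← nhdsWithin_Ico_eq_nhdsLT hc.1, ← image_subtype_val_Icc_Iio ⟨c, Ioc_subset_Icc_self hc⟩,
    ← IsEmbedding.subtypeVal.map_nhdsWithin_eq (Iio _) ⟨c, _⟩, tendsto_map'_iff]

theorem isRegulated_of_dist_le_mul [PseudoMetricSpace X] [CompleteSpace X] {f : Icc a b → X}
    {h : ℝ → ℝ} {C : ℝ} (hh : MonotoneOn h (Icc a b))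
    (hf : ∀ s t : Icc a b, dist (f s) (f t) ≤ C * dist (h s) (h t)) : IsRegulated f := by
  have hmono : Monotone fun t : Icc a b => h t := fun s t hst => hh s.2 t.2 hst
  intro t
  have : Nonempty X := ⟨f t⟩
  exact ⟨exists_tendsto_of_dist_le_mul (g := fun s : Icc a b => h s) hf (hmono.tendsto_nhdsLT t),
    exists_tendsto_of_dist_le_mul (g := fun s : Icc a b => h s) hf (hmono.tendsto_nhdsGT t)⟩

theorem IsRegulated.exists_finset_dist_lt [PseudoMetricSpace X] {f : Icc a b → X}
    (hf : IsRegulated f) {ε : ℝ} (hε : 0 < ε) :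
    ∃ E : Finset ℝ, ∀ u v : Icc a b, Disjoint (E : Set ℝ) (uIcc (u : ℝ) v) →
      dist (f u) (f v) < ε := by
  have hlocal : ∀ t : Icc a b, ∃ s ∈ 𝓝 t, ∃ E : Finset ℝ, ∀ u ∈ s, ∀ v : Icc a b,
      Disjoint (E : Set ℝ) (uIcc (u : ℝ) v) → dist (f u) (f v) < ε := by
    intro t
    obtain ⟨⟨l, hl⟩, ⟨r, hr⟩⟩ := hf t
    have hleft := eventually_nhdsWithin_iff.1 (hl (Metric.ball_mem_nhds l (half_pos hε)))
    have hright := eventually_nhdsWithin_iff.1 (hr (Metric.ball_mem_nhds r (half_pos hε)))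
    obtain ⟨d, hd, hball⟩ := Metric.eventually_nhds_iff.1 (hleft.and hright)
    refine ⟨Metric.ball t d, Metric.ball_mem_nhds t hd, {(t : ℝ) - d, (t : ℝ), (t : ℝ) + d},
      fun u hu v huv => ?_⟩
    have havoid : ∀ e : ℝ, e = t - d ∨ e = t ∨ e = t + d → e ∉ uIcc (u : ℝ) v := fun e he =>
      disjoint_left.1 huv (by simpa using he)
    have hv : v ∈ Metric.ball t d ∧ (u < t ∧ v < t ∨ t < u ∧ t < v) := by
      have h₁ := havoid (t - d) (Or.inl rfl)
      have h₂ := havoid t (Or.inr (Or.inl rfl))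
      have h₃ := havoid (t + d) (Or.inr (Or.inr rfl))
      rw [Metric.mem_ball, Subtype.dist_eq, Real.dist_eq, abs_lt] at hu ⊢
      simp only [mem_uIcc, ← Subtype.coe_lt_coe] at h₁ h₂ h₃ ⊢
      grind
    obtain ⟨hvball, ⟨hut, hvt⟩ | ⟨hut, hvt⟩⟩ := hv
    · exact (dist_triangle_right _ _ l).trans_lt
        ((add_lt_add ((hball hu).1 hut) ((hball hvball).1 hvt)).trans_eq (add_halves ε))
    · exact (dist_triangle_right _ _ r).trans_lt
        ((add_lt_add ((hball hu).2 hut) ((hball hvball).2 hvt)).trans_eq (add_halves ε))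
  choose s hs E hE using hlocal
  obtain ⟨F, hF⟩ := CompactSpace.elim_nhds_subcover s hs
  refine ⟨F.biUnion E, fun u v huv => ?_⟩
  obtain ⟨t, htF, hut⟩ := mem_iUnion₂.1 (hF.ge (mem_univ u))
  exact hE t u hut v (huv.mono_left (mod_cast Finset.subset_biUnion_of_mem E htF))

end IsRegulated

/-! ### The Kurzweil integral -/

section Integral

open TaggedPartition

variable {a b c : ℝ} {X : Type*} [NormedAddCommGroup X] {U V : ℝ → ℝ → X} {I J : X}

theorem hasKurzweilIntegral_iff_tendsto : HasKurzweilIntegral U a b I ↔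
    Tendsto (fun P : TaggedPartition a b => P.sum U) (fineFilter a b) (𝓝 I) := by
  rw [(hasBasis_fineFilter a b).tendsto_iff Metric.nhds_basis_ball]
  simp [HasKurzweilIntegral, dist_eq_norm]

theorem hasKurzweilIntegral_const (f : ℝ → X) (a b : ℝ) :
    HasKurzweilIntegral (fun _ => f) a b (f b - f a) := by
  simpa only [hasKurzweilIntegral_iff_tendsto, sum_const] using tendsto_const_nhds

namespace HasKurzweilIntegral

theorem unique (hab : a ≤ b) (hI : HasKurzweilIntegral U a b I)
    (hJ : HasKurzweilIntegral U a b J) : I = J :=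
  have := fineFilter_neBot hab
  tendsto_nhds_unique (hasKurzweilIntegral_iff_tendsto.1 hI) (hasKurzweilIntegral_iff_tendsto.1 hJ)

theorem congr (hU : HasKurzweilIntegral U a b I) (hUV : ∀ τ ∈ Icc a b, U τ = V τ) :
    HasKurzweilIntegral V a b I := by
  rw [hasKurzweilIntegral_iff_tendsto] at *
  simpa only [sum_congr _ hUV] using hU

theorem add (hU : HasKurzweilIntegral U a b I) (hV : HasKurzweilIntegral V a b J) :
    HasKurzweilIntegral (U + V) a b (I + J) := by
  rw [hasKurzweilIntegral_iff_tendsto] at *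
  simpa only [← coe_sumHom, map_add] using Tendsto.add hU hV

theorem sub (hU : HasKurzweilIntegral U a b I) (hV : HasKurzweilIntegral V a b J) :
    HasKurzweilIntegral (U - V) a b (I - J) := by
  rw [hasKurzweilIntegral_iff_tendsto] at *
  simpa only [← coe_sumHom, map_sub] using Tendsto.sub hU hV

theorem smul [NormedSpace ℝ X] (r : ℝ) (hU : HasKurzweilIntegral U a b I) :
    HasKurzweilIntegral (r • U) a b (r • I) := by
  rw [hasKurzweilIntegral_iff_tendsto] at *
  simpa only [sum_smul] using hU.const_smul r

theorem sum {ι : Type*} {s : Finset ι} {U : ι → ℝ → ℝ → X} {I : ι → X}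
    (hU : ∀ i ∈ s, HasKurzweilIntegral (U i) a b (I i)) :
    HasKurzweilIntegral (∑ i ∈ s, U i) a b (∑ i ∈ s, I i) := by
  simp only [hasKurzweilIntegral_iff_tendsto, ← coe_sumHom, map_sum] at *
  exact tendsto_finsetSum s hU

end HasKurzweilIntegral

theorem hasKurzweilIntegral_self (U : ℝ → ℝ → X) (a : ℝ) : HasKurzweilIntegral U a a 0 := by
  rw [← sub_self (U a a)]
  exact (hasKurzweilIntegral_const (U a) a a).congr fun τ hτ => by rw [le_antisymm hτ.2 hτ.1]

theorem HasKurzweilIntegral.norm_sub_le {h : ℝ → ℝ} {C : ℝ} (hab : a ≤ b) (hbc : b ≤ c)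
    (hh : MonotoneOn h (Icc b c))
    (hU : ∀ τ ∈ Icc b c, ∀ s ∈ Icc b c, ∀ t ∈ Icc b c, ‖U τ t - U τ s‖ ≤ C * |h t - h s|)
    (hI : HasKurzweilIntegral U a b I) (hJ : HasKurzweilIntegral U a c J) :
    ‖J - I‖ ≤ C * (h c - h b) := by
  have := fineFilter_neBot hab
  have := fineFilter_neBot hbc
  rw [hasKurzweilIntegral_iff_tendsto] at hI hJ
  refine le_of_tendsto ((hJ.comp tendsto_append).sub
    (hI.comp (tendsto_fst (g := fineFilter b c)))).norm (Eventually.of_forall fun p => ?_)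
  simpa only [Function.comp_apply, sum_append, add_sub_cancel_left] using p.2.norm_sum_le hh hU

section Indicator

variable {D : Set ℝ} {f : ℝ → X}

theorem hasKurzweilIntegral_indicator_Iic (hc : c ∈ Ico a b) (hf : Tendsto f (𝓝[>] c) (𝓝 I)) :
    HasKurzweilIntegral ((Iic c).indicator fun _ => f) a b (I - f a) := by
  simpa only [hasKurzweilIntegral_iff_tendsto, sum_indicator _ (isLowerSet_Iic c)] using!
    (hf.comp (tendsto_t_exitIndex_Iic hc)).sub_const (f a)

theorem hasKurzweilIntegral_indicator_Iio (hc : c ∈ Ioc a b) (hf : Tendsto f (𝓝[<] c) (𝓝 I)) :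
    HasKurzweilIntegral ((Iio c).indicator fun _ => f) a b (I - f a) := by
  simpa only [hasKurzweilIntegral_iff_tendsto, sum_indicator _ (isLowerSet_Iio c)] using!
    (hf.comp (tendsto_t_exitIndex_Iio hc)).sub_const (f a)

theorem exists_hasKurzweilIntegral_indicator_of_isLowerSet
    (hf : IsRegulated fun t : Icc a b => f t) (hD : IsLowerSet D) :
    ∃ I, HasKurzweilIntegral (D.indicator fun _ => f) a b I := by
  by_cases hbD : b ∈ D
  · refine ⟨_, (hasKurzweilIntegral_const f a b).congr fun τ hτ => ?_⟩
    rw [indicator_of_mem (hD hτ.2 hbD)]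
  by_cases haD : a ∈ D
  swap
  · refine ⟨_, (hasKurzweilIntegral_const 0 a b).congr fun τ hτ => ?_⟩
    rw [indicator_of_notMem fun hτD => haD (hD hτ.1 hτD)]
  have hlub : IsLUB D (sSup D) :=
    isLUB_csSup ⟨a, haD⟩ ⟨b, fun x hx => le_of_not_ge fun hbx => hbD (hD hbx hx)⟩
  have ha : a ≤ sSup D := hlub.1 haD
  have hb : sSup D ≤ b := hlub.2 fun x hx => le_of_not_ge fun hbx => hbD (hD hbx hx)
  rcases eq_Iio_or_eq_Iic_of_isLowerSet hD hlub with h | h <;> rw [h] at haD hbD ⊢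
  · obtain ⟨l, hl⟩ := hf.exists_tendsto_nhdsLT ⟨haD, hb⟩
    exact ⟨_, hasKurzweilIntegral_indicator_Iio ⟨haD, hb⟩ hl⟩
  · obtain ⟨r, hr⟩ := hf.exists_tendsto_nhdsGT ⟨ha, not_le.1 hbD⟩
    exact ⟨_, hasKurzweilIntegral_indicator_Iic ⟨ha, not_le.1 hbD⟩ hr⟩

theorem exists_hasKurzweilIntegral_indicator_of_ordConnected
    (hf : IsRegulated fun t : Icc a b => f t) (hD : D.OrdConnected) :
    ∃ I, HasKurzweilIntegral (D.indicator fun _ => f) a b I := by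
  have hlower : IsLowerSet (lowerClosure D \ D : Set ℝ) := by
    rintro x y hyx ⟨hx, hxD⟩
    refine ⟨(lowerClosure D).lower hyx hx, fun hyD => hxD ?_⟩
    obtain ⟨z, hzD, hxz⟩ := hx
    exact hD.out hyD hzD ⟨hyx, hxz⟩
  obtain ⟨I, hI⟩ := exists_hasKurzweilIntegral_indicator_of_isLowerSet hf (lowerClosure D).lower
  obtain ⟨J, hJ⟩ := exists_hasKurzweilIntegral_indicator_of_isLowerSet hf hlower
  refine ⟨I - J, ?_⟩
  rw [← sdiff_sdiff_cancel_left (subset_lowerClosure (s := D)), indicator_sdiff sdiff_subset]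
  exact hI.sub hJ

theorem exists_hasKurzweilIntegral_of_finite {ι : Type*} [Finite ι] {κ : ℝ → ι}
    (hκ : ∀ k, (κ ⁻¹' {k}).OrdConnected) {f : ι → ℝ → X}
    (hf : ∀ k, IsRegulated fun t : Icc a b => f k t) :
    ∃ I, HasKurzweilIntegral (fun τ => f (κ τ)) a b I := by
  classical
  have := Fintype.ofFinite ι
  choose I hI using fun k => exists_hasKurzweilIntegral_indicator_of_ordConnected (hf k) (hκ k)
  refine ⟨∑ k, I k, (HasKurzweilIntegral.sum fun k _ => hI k).congr fun τ _ => ?_⟩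
  simp [Finset.sum_apply, indicator_apply]

end Indicator

theorem exists_hasKurzweilIntegral [CompleteSpace X] {h : ℝ → ℝ} (hab : a ≤ b)
    (hh : MonotoneOn h (Icc a b)) (hreg : ∀ τ ∈ Icc a b, IsRegulated fun t : Icc a b => U τ t)
    (hosc : ∀ ε > 0, ∃ E : Finset ℝ, ∀ u ∈ Icc a b, ∀ v ∈ Icc a b,
      Disjoint (E : Set ℝ) (uIcc u v) → ∀ s ∈ Icc a b, ∀ t ∈ Icc a b,
        ‖U u t - U u s - U v t + U v s‖ ≤ ε * |h t - h s|) :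
    ∃ I, HasKurzweilIntegral U a b I := by
  simp only [hasKurzweilIntegral_iff_tendsto]
  refine exists_tendsto_of_forall_exists_dist_le fun ε hε => ?_
  have hhab : 0 ≤ h b - h a :=
    sub_nonneg.2 (hh (left_mem_Icc.2 hab) (right_mem_Icc.2 hab) hab)
  obtain ⟨E, hE⟩ := hosc (ε / (h b - h a + 1)) (by positivity)
  have : Nonempty (Icc a b) := ⟨⟨a, left_mem_Icc.2 hab⟩⟩
  -- `κ u` is the position of `u` relative to the points of `E`. Its fibres are intervals, and on
  -- each of them `U` is replaced by its value at a single point `r`.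
  let κ : ℝ → E → SignType := fun u e => SignType.sign (u - e)
  have hκ : Monotone κ := fun u v huv e => SignType.sign.monotone (sub_le_sub_right huv _)
  let r : (E → SignType) → Icc a b := Function.invFun fun t : Icc a b => κ t
  have hr : ∀ τ ∈ Icc a b, κ (r (κ τ)) = κ τ := fun τ hτ =>
    Function.invFun_eq (f := fun t : Icc a b => κ t) ⟨⟨τ, hτ⟩, rfl⟩
  let V : ℝ → ℝ → X := fun τ => U (r (κ τ))
  have hUV : ∀ τ ∈ Icc a b, ∀ s ∈ Icc a b, ∀ t ∈ Icc a b,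
      ‖(U - V) τ t - (U - V) τ s‖ ≤ ε / (h b - h a + 1) * |h t - h s| := by
    intro τ hτ s hs t ht
    by_cases hτr : τ = r (κ τ)
    · simp only [V, Pi.sub_apply, ← hτr, sub_self, norm_zero]
      positivity
    · have hdisj : Disjoint (E : Set ℝ) (uIcc τ (r (κ τ))) := disjoint_left.2 fun e heE he =>
        hτr (eq_of_sign_sub_eq_of_mem_uIcc he (congrFun (hr τ hτ).symm ⟨e, heE⟩))
      convert hE τ hτ _ (r (κ τ)).2 hdisj s hs t ht using 2
      simp only [V, Pi.sub_apply]
      abel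
  refine ⟨fun P => P.sum V, fun P => ?_, ?_⟩
  · calc dist (P.sum U) (P.sum V) = ‖P.sum (U - V)‖ := by
          rw [dist_eq_norm, ← coe_sumHom, map_sub]
      _ ≤ ε / (h b - h a + 1) * (h b - h a) := P.norm_sum_le hh hUV
      _ ≤ ε := by
          rw [div_mul_eq_mul_div, div_le_iff₀ (by positivity)]
          nlinarith
  · simp only [← hasKurzweilIntegral_iff_tendsto]
    exact exists_hasKurzweilIntegral_of_finite (fun k => ordConnected_singleton.preimage_mono hκ)
      fun k => hreg _ (r k).2

end Integral

/-! ### The space of regulated functions -/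

namespace RegulatedSpace

variable {a b : ℝ} {X : Type*} [NormedAddCommGroup X] [NormedSpace ℝ X]

theorem eval_coe (x : RegulatedSpace a b X) (t : Icc a b) :
    x.eval t = (x : lp (fun _ : Icc a b => X) ∞) t := dif_pos t.2

theorem eval_mk {f : Icc a b → X} (hf : IsRegulated f) (t : Icc a b) : (mk f hf).eval t = f t :=
  eval_coe _ t

theorem isRegulated_eval (x : RegulatedSpace a b X) : IsRegulated fun t : Icc a b => x.eval t := by
  simp only [eval_coe]
  exact x.2

theorem ext_eval {x y : RegulatedSpace a b X} (h : ∀ t ∈ Icc a b, x.eval t = y.eval t) :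
    x = y := by
  refine Subtype.ext (lp.ext (funext fun t => ?_))
  simpa only [eval_coe] using h t t.2

theorem eval_add (x y : RegulatedSpace a b X) (t : ℝ) :
    (x + y).eval t = x.eval t + y.eval t := by
  by_cases ht : t ∈ Icc a b <;> simp [eval, ht]

theorem eval_sub (x y : RegulatedSpace a b X) (t : ℝ) :
    (x - y).eval t = x.eval t - y.eval t := by
  by_cases ht : t ∈ Icc a b <;> simp [eval, ht]

theorem eval_smul (r : ℝ) (x : RegulatedSpace a b X) (t : ℝ) :
    (r • x).eval t = r • x.eval t := by
  by_cases ht : t ∈ Icc a b <;> simp [eval, ht]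

theorem norm_eval_le (x : RegulatedSpace a b X) (t : ℝ) : ‖x.eval t‖ ≤ ‖x‖ := by
  by_cases ht : t ∈ Icc a b
  · rw [eval_coe x ⟨t, ht⟩]
    exact lp.norm_apply_le_norm ENNReal.top_ne_zero _ _
  · simp [eval, ht]

/-- Evaluation at `t` as a continuous linear map on the space of regulated functions. -/
noncomputable def evalCLM (t : ℝ) : RegulatedSpace a b X →L[ℝ] X :=
  LinearMap.mkContinuous
    { toFun := fun x => x.eval t
      map_add' := fun x y => eval_add x y t
      map_smul' := fun r x => eval_smul r x t } 1
    fun x => (x.norm_eval_le t).trans_eq (one_mul _).symm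

theorem norm_le {x : RegulatedSpace a b X} {C : ℝ} (hC : 0 ≤ C)
    (h : ∀ t ∈ Icc a b, ‖x.eval t‖ ≤ C) : ‖x‖ ≤ C := by
  refine lp.norm_le_of_forall_le hC fun t => ?_
  exact (congrArg norm (x.eval_coe t)).ge.trans (h t t.2)

theorem isClosed_regulatedSubmodule [CompleteSpace X] :
    IsClosed (regulatedSubmodule a b X : Set (lp (fun _ : Icc a b => X) ∞)) := by
  refine isClosed_of_closure_subset fun x hx => ?_
  have happrox : ∀ ε > 0, ∃ y : Icc a b → X, IsRegulated y ∧ ∀ t, dist (x t) (y t) ≤ ε := by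
    intro ε hε
    obtain ⟨y, hy, hxy⟩ := Metric.mem_closure_iff.1 hx ε hε
    refine ⟨y, hy, fun t => ?_⟩
    rw [dist_eq_norm] at hxy ⊢
    exact (lp.norm_apply_le_norm ENNReal.top_ne_zero (x - y) t).trans hxy.le
  refine fun t => ⟨exists_tendsto_of_forall_exists_dist_le fun ε hε => ?_,
    exists_tendsto_of_forall_exists_dist_le fun ε hε => ?_⟩
  all_goals obtain ⟨y, hy, hxy⟩ := happrox ε hε
  exacts [⟨y, hxy, (hy t).1⟩, ⟨y, hxy, (hy t).2⟩]

instance [CompleteSpace X] : CompleteSpace (RegulatedSpace a b X) :=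
  isClosed_regulatedSubmodule.completeSpace_coe

theorem totallyBounded_of_norm_sub_le [ProperSpace X] {S : Set (RegulatedSpace a b X)}
    {h : ℝ → ℝ} {C : ℝ} (hh : MonotoneOn h (Icc a b)) (hbdd : ∀ x ∈ S, ‖x‖ ≤ C)
    (hS : ∀ x ∈ S, ∀ s ∈ Icc a b, ∀ t ∈ Icc a b, ‖x.eval t - x.eval s‖ ≤ C * |h t - h s|) :
    TotallyBounded S := by
  refine Metric.totallyBounded_iff.2 fun ε hε => ?_
  have hε4 : 0 < ε / 4 := by positivity
  obtain ⟨N, hN, hNfin, hnet⟩ := exists_finite_subset_forall_mul_abs_sub_le hh C hε4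
  have := hNfin.fintype
  have heval : TotallyBounded ((fun (x : RegulatedSpace a b X) (t : N) => x.eval t) '' S) := by
    refine (isCompact_closedBall (0 : N → X) |C|).totallyBounded.subset ?_
    rintro _ ⟨x, hx, rfl⟩
    exact mem_closedBall_zero_iff.2 <| (pi_norm_le_iff_of_nonneg (abs_nonneg C)).2 fun t =>
      (x.norm_eval_le t).trans ((hbdd x hx).trans (le_abs_self C))
  obtain ⟨R, hRS, hRfin, hR⟩ := exists_finite_subset_dist_image_lt heval hε4
  refine ⟨R, hRfin, fun x hx => ?_⟩
  obtain ⟨y, hyR, hxy⟩ := hR x hx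
  refine mem_iUnion₂.2 ⟨y, hyR, ?_⟩
  rw [Metric.mem_ball, dist_eq_norm]
  refine (norm_le (C := 3 * (ε / 4)) (by positivity) fun t ht => ?_).trans_lt (by linarith)
  obtain ⟨s, hsN, hts⟩ := hnet t ht
  have hxt : dist (x.eval t) (x.eval s) ≤ ε / 4 :=
    (dist_eq_norm _ _).trans_le ((hS x hx s (hN hsN) t ht).trans hts)
  have hyt : dist (y.eval t) (y.eval s) ≤ ε / 4 :=
    (dist_eq_norm _ _).trans_le ((hS y (hRS hyR) s (hN hsN) t ht).trans hts)
  have hxys : dist (x.eval s) (y.eval s) ≤ ε / 4 :=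
    (dist_le_pi_dist (fun r : N => x.eval r) (fun r => y.eval r) ⟨s, hsN⟩).trans hxy.le
  rw [eval_sub, ← dist_eq_norm]
  linarith [dist_triangle4_right (x.eval t) (y.eval t) (x.eval s) (y.eval s)]

theorem isCompactOperator_of_norm_sub_le {E : Type*} [NormedAddCommGroup E] [NormedSpace ℝ E]
    [ProperSpace X] (L : E →L[ℝ] RegulatedSpace a b X) {h : ℝ → ℝ}
    (hh : MonotoneOn h (Icc a b)) (hL : ∀ z, ∀ s ∈ Icc a b, ∀ t ∈ Icc a b,
      ‖(L z).eval t - (L z).eval s‖ ≤ ‖z‖ * |h t - h s|) : IsCompactOperator L := by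
  refine (isCompactOperator_iff_isCompact_closure_image_closedBall
    (L : E →ₗ[ℝ] RegulatedSpace a b X) one_pos).2 ?_
  have htb : TotallyBounded (L '' Metric.closedBall 0 1) := by
    refine totallyBounded_of_norm_sub_le (C := max ‖L‖ 1) hh ?_ ?_
    · rintro _ ⟨z, hz, rfl⟩
      exact (L.unit_le_opNorm z (mem_closedBall_zero_iff.1 hz)).trans (le_max_left _ _)
    · rintro _ ⟨z, hz, rfl⟩ s hs t ht
      exact (hL z s hs t ht).trans (mul_le_mul_of_nonneg_right
        ((mem_closedBall_zero_iff.1 hz).trans (le_max_right _ _)) (abs_nonneg _))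
  exact htb.closure.isCompact_of_isClosed isClosed_closure

end RegulatedSpace

/-! ### Kurzweil primitives -/

section Primitive

variable {a b : ℝ} {X : Type*} [NormedAddCommGroup X] {U V : ℝ → ℝ → X} {h : ℝ → ℝ} {C : ℝ}

theorem HasKurzweilIntegral.norm_sub_le_mul_abs {s t : ℝ} {I J : X} (hh : MonotoneOn h (Icc a b))
    (hU : ∀ τ ∈ Icc a b, ∀ s ∈ Icc a b, ∀ t ∈ Icc a b, ‖U τ t - U τ s‖ ≤ C * |h t - h s|)
    (hs : s ∈ Icc a b) (ht : t ∈ Icc a b) (hI : HasKurzweilIntegral U a s I)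
    (hJ : HasKurzweilIntegral U a t J) : ‖J - I‖ ≤ C * |h t - h s| := by
  wlog hst : s ≤ t generalizing s t I J
  · rw [norm_sub_rev, abs_sub_comm]
    exact this ht hs hJ hI (le_of_not_ge hst)
  have hsub : Icc s t ⊆ Icc a b := Icc_subset_Icc hs.1 ht.2
  rw [abs_of_nonneg (sub_nonneg.2 (hh hs ht hst))]
  exact hI.norm_sub_le hs.1 hst (hh.mono hsub)
    (fun τ hτ r hr u hu => hU τ (hsub hτ) r (hsub hr) u (hsub hu)) hJ

variable [NormedSpace ℝ X] {c d : X} {v w : RegulatedSpace a b X}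

/-- The relation `w(s) = c + ∫_a^s DU(τ, t)` for all `s ∈ [a, b]`, including the existence of these
integrals. -/
def IsKurzweilPrimitive (U : ℝ → ℝ → X) (c : X) (w : RegulatedSpace a b X) : Prop :=
  ∀ s ∈ Icc a b, HasKurzweilIntegral U a s (w.eval s - c)

namespace IsKurzweilPrimitive

theorem unique (hv : IsKurzweilPrimitive U c v) (hw : IsKurzweilPrimitive U c w) : v = w :=
  RegulatedSpace.ext_eval fun s hs => sub_left_injective ((hv s hs).unique hs.1 (hw s hs))

theorem add (hv : IsKurzweilPrimitive U c v) (hw : IsKurzweilPrimitive V d w) :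
    IsKurzweilPrimitive (U + V) (c + d) (v + w) := fun s hs => by
  rw [RegulatedSpace.eval_add, add_sub_add_comm]
  exact (hv s hs).add (hw s hs)

theorem smul (r : ℝ) (hw : IsKurzweilPrimitive U c w) :
    IsKurzweilPrimitive (r • U) (r • c) (r • w) := fun s hs => by
  rw [RegulatedSpace.eval_smul, ← smul_sub]
  exact (hw s hs).smul r

theorem eval_left (hab : a ≤ b) (hw : IsKurzweilPrimitive U c w) : w.eval a = c :=
  sub_eq_zero.1 ((hw a (left_mem_Icc.2 hab)).unique le_rfl (hasKurzweilIntegral_self U a))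

theorem norm_eval_sub_le (hw : IsKurzweilPrimitive U c w) (hh : MonotoneOn h (Icc a b))
    (hU : ∀ τ ∈ Icc a b, ∀ s ∈ Icc a b, ∀ t ∈ Icc a b, ‖U τ t - U τ s‖ ≤ C * |h t - h s|)
    {s t : ℝ} (hs : s ∈ Icc a b) (ht : t ∈ Icc a b) :
    ‖w.eval t - w.eval s‖ ≤ C * |h t - h s| := by
  simpa only [sub_sub_sub_cancel_right] using (hw s hs).norm_sub_le_mul_abs hh hU hs ht (hw t ht)

theorem norm_le (hw : IsKurzweilPrimitive U c w) (hab : a ≤ b) (hC : 0 ≤ C)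
    (hh : MonotoneOn h (Icc a b))
    (hU : ∀ τ ∈ Icc a b, ∀ s ∈ Icc a b, ∀ t ∈ Icc a b, ‖U τ t - U τ s‖ ≤ C * |h t - h s|) :
    ‖w‖ ≤ ‖c‖ + C * (h b - h a) := by
  have ha := left_mem_Icc.2 hab
  have hb := right_mem_Icc.2 hab
  refine RegulatedSpace.norm_le
    (add_nonneg (norm_nonneg c) (mul_nonneg hC (sub_nonneg.2 (hh ha hb hab)))) fun t ht => ?_
  calc ‖w.eval t‖ ≤ ‖w.eval a‖ + ‖w.eval t - w.eval a‖ := norm_le_insert' _ _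
    _ ≤ ‖c‖ + C * |h t - h a| :=
        add_le_add (hw.eval_left hab ▸ le_rfl) (hw.norm_eval_sub_le hh hU ha ht)
    _ = ‖c‖ + C * (h t - h a) := by rw [abs_of_nonneg (sub_nonneg.2 (hh ha ht ht.1))]
    _ ≤ ‖c‖ + C * (h b - h a) := by gcongr; exact hh ht hb ht.2

end IsKurzweilPrimitive

theorem exists_isKurzweilPrimitive [CompleteSpace X] (hh : MonotoneOn h (Icc a b))
    (hU : ∀ τ ∈ Icc a b, ∀ s ∈ Icc a b, ∀ t ∈ Icc a b, ‖U τ t - U τ s‖ ≤ C * |h t - h s|)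
    (hint : ∀ s ∈ Icc a b, ∃ J, HasKurzweilIntegral U a s J) (c : X) :
    ∃ w : RegulatedSpace a b X, IsKurzweilPrimitive U c w := by
  choose J hJ using fun s : Icc a b => hint s s.2
  have hreg : IsRegulated fun s : Icc a b => c + J s :=
    isRegulated_of_dist_le_mul (C := C) hh fun s t => by
      rw [dist_add_left, dist_eq_norm]
      exact (hJ t).norm_sub_le_mul_abs hh hU t.2 s.2 (hJ s)
  refine ⟨RegulatedSpace.mk _ hreg, fun s hs => ?_⟩
  rw [RegulatedSpace.eval_mk hreg ⟨s, hs⟩, add_sub_cancel_left]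
  exact hJ ⟨s, hs⟩

theorem exists_isCompactOperator_isKurzweilPrimitive [ProperSpace X] {E : Type*}
    [NormedAddCommGroup E] [NormedSpace ℝ E] (hab : a ≤ b) (hh : MonotoneOn h (Icc a b))
    (U : E →ₗ[ℝ] ℝ → ℝ → X) (c : E →L[ℝ] X)
    (hU : ∀ z, ∀ τ ∈ Icc a b, ∀ s ∈ Icc a b, ∀ t ∈ Icc a b,
      ‖U z τ t - U z τ s‖ ≤ ‖z‖ * |h t - h s|)
    (hint : ∀ z, ∀ s ∈ Icc a b, ∃ J, HasKurzweilIntegral (U z) a s J) :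
    ∃ K : E →L[ℝ] RegulatedSpace a b X, IsCompactOperator K ∧
      ∀ z, IsKurzweilPrimitive (U z) (c z) (K z) := by
  choose K hK using fun z => exists_isKurzweilPrimitive hh (hU z) (hint z) (c z)
  let L : E →ₗ[ℝ] RegulatedSpace a b X :=
    { toFun := K
      map_add' := fun y z => (hK _).unique (by simpa only [map_add] using (hK y).add (hK z))
      map_smul' := fun r z => (hK _).unique (by
        simpa only [map_smul, RingHom.id_apply] using (hK z).smul r) }
  have hbound : ∀ z, ‖L z‖ ≤ (‖c‖ + (h b - h a)) * ‖z‖ := fun z =>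
    calc ‖L z‖ ≤ ‖c z‖ + ‖z‖ * (h b - h a) := (hK z).norm_le hab (norm_nonneg z) hh (hU z)
      _ ≤ ‖c‖ * ‖z‖ + ‖z‖ * (h b - h a) := by gcongr; exact c.le_opNorm z
      _ = (‖c‖ + (h b - h a)) * ‖z‖ := by ring
  exact ⟨L.mkContinuous _ hbound, RegulatedSpace.isCompactOperator_of_norm_sub_le _ hh
    fun z s hs t ht => (hK z).norm_eval_sub_le hh (hU z) hs ht, hK⟩

end Primitive

/-! ### The linearized equation -/

theorem IsKurzweilPrimitive.forall_exists_sub_eq_iff {a b : ℝ} {X : Type*} [NormedAddCommGroup X]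
    [NormedSpace ℝ X] {U : ℝ → ℝ → X} {c : X} {w : RegulatedSpace a b X}
    (hw : IsKurzweilPrimitive U c w) (z q : RegulatedSpace a b X) :
    (∀ s ∈ Icc a b, ∃ J, HasKurzweilIntegral U a s J ∧ z.eval s - c - J = q.eval s) ↔
      z - w = q := by
  constructor
  · refine fun hz => RegulatedSpace.ext_eval fun s hs => ?_
    obtain ⟨J, hJ, hq⟩ := hz s hs
    rw [← hq, hJ.unique hs.1 (hw s hs), RegulatedSpace.eval_sub, sub_sub_sub_cancel_right]
  · rintro rfl s hs
    exact ⟨_, hw s hs, by rw [RegulatedSpace.eval_sub, sub_sub_sub_cancel_right]⟩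

namespace KurzweilClass

variable {a b : ℝ} {Z X Y : Type*} [NormedAddCommGroup Z] [NormedAddCommGroup X] [NormedSpace ℝ X]
  [NormedAddCommGroup Y] [NormedSpace ℝ Y] {Ω : Set Z} {h ω : ℝ → ℝ} {A : Z → ℝ → X →L[ℝ] Y}

theorem norm_apply_sub_le (hA : KurzweilClass Ω a b h ω A) {x : Z} (hx : x ∈ Ω) {s t : ℝ}
    (hs : s ∈ Icc a b) (ht : t ∈ Icc a b) (v : X) :
    ‖A x t v - A x s v‖ ≤ ‖v‖ * |h t - h s| := by
  rw [← sub_apply, mul_comm]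
  exact (A x t - A x s).le_of_opNorm_le (hA.bound x hx s hs t ht) v

theorem norm_apply_sub_sub_add_le (hA : KurzweilClass Ω a b h ω A) {x y : Z} (hx : x ∈ Ω)
    (hy : y ∈ Ω) {s t : ℝ} (hs : s ∈ Icc a b) (ht : t ∈ Icc a b) (v w : X) :
    ‖A x t v - A x s v - A y t w + A y s w‖ ≤ (ω ‖x - y‖ * ‖v‖ + ‖v - w‖) * |h t - h s| :=
  calc ‖A x t v - A x s v - A y t w + A y s w‖
      = ‖(A x t - A x s - A y t + A y s) v + (A y t (v - w) - A y s (v - w))‖ := by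
        simp only [add_apply, sub_apply, map_sub]
        congr 1
        abel
    _ ≤ ω ‖x - y‖ * |h t - h s| * ‖v‖ + ‖v - w‖ * |h t - h s| :=
        norm_add_le_of_le
          (ContinuousLinearMap.le_of_opNorm_le _ (hA.bound_diff x hx y hy s hs t ht) v)
          (hA.norm_apply_sub_le hy hs ht _)
    _ = (ω ‖x - y‖ * ‖v‖ + ‖v - w‖) * |h t - h s| := by ring

theorem exists_finset_norm_apply_sub_sub_add_le (hA : KurzweilClass Ω a b h ω A) {x : ℝ → Z}
    (hx : IsRegulated fun t : Icc a b => x t) (hxΩ : ∀ t ∈ Icc a b, x t ∈ Ω) {z : ℝ → X}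
    (hz : IsRegulated fun t : Icc a b => z t) {ε : ℝ} (hε : 0 < ε) :
    ∃ E : Finset ℝ, ∀ u ∈ Icc a b, ∀ v ∈ Icc a b, Disjoint (E : Set ℝ) (uIcc u v) →
      ∀ s ∈ Icc a b, ∀ t ∈ Icc a b,
        ‖A (x u) t (z u) - A (x u) s (z u) - A (x v) t (z v) + A (x v) s (z v)‖ ≤
          ε * |h t - h s| := by
  classical
  obtain ⟨C, hC⟩ := hz.exists_bound
  obtain ⟨d, hd, hω⟩ := Metric.continuousOn_iff.1 hA.ω_cont 0 self_mem_Ici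
    (ε / (2 * (|C| + 1))) (by positivity)
  obtain ⟨E, hE⟩ := hx.exists_finset_dist_lt hd
  obtain ⟨E', hE'⟩ := hz.exists_finset_dist_lt (half_pos hε)
  refine ⟨E ∪ E', fun u hu v hv huv s hs t ht => ?_⟩
  rw [Finset.coe_union, disjoint_union_left] at huv
  have hxuv : ω ‖x u - x v‖ ≤ ε / (2 * (|C| + 1)) := by
    have hnorm := hE ⟨u, hu⟩ ⟨v, hv⟩ huv.1
    rw [dist_eq_norm] at hnorm
    have hdist := hω ‖x u - x v‖ (norm_nonneg _) (by simpa using hnorm)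
    rw [hA.ω_zero, dist_zero_right] at hdist
    exact (le_abs_self _).trans hdist.le
  have hzuv : ‖z u - z v‖ ≤ ε / 2 := by
    simpa only [dist_eq_norm] using (hE' ⟨u, hu⟩ ⟨v, hv⟩ huv.2).le
  have hzu : ‖z u‖ ≤ |C| + 1 := by linarith [hC ⟨u, hu⟩, le_abs_self C]
  refine (hA.norm_apply_sub_sub_add_le (hxΩ u hu) (hxΩ v hv) hs ht _ _).trans ?_
  gcongr
  calc ω ‖x u - x v‖ * ‖z u‖ + ‖z u - z v‖
      ≤ ε / (2 * (|C| + 1)) * (|C| + 1) + ε / 2 := by gcongr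
    _ = ε := by field_simp; ring

theorem exists_hasKurzweilIntegral [CompleteSpace Y] (hA : KurzweilClass Ω a b h ω A) {x : ℝ → Z}
    (hx : IsRegulated fun t : Icc a b => x t) (hxΩ : ∀ t ∈ Icc a b, x t ∈ Ω) {z : ℝ → X}
    (hz : IsRegulated fun t : Icc a b => z t) {c : ℝ} (hc : c ∈ Icc a b) :
    ∃ J, HasKurzweilIntegral (fun τ t => A (x τ) t (z τ)) a c J := by
  have hsub : Icc a c ⊆ Icc a b := Icc_subset_Icc_right hc.2
  have hmono := hA.h_mono.mono hsub
  refine _root_.exists_hasKurzweilIntegral hc.1 hmono (fun τ hτ => ?_) fun ε hε => ?_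
  · refine isRegulated_of_dist_le_mul (C := ‖z τ‖) hmono fun s t => ?_
    rw [dist_eq_norm]
    exact hA.norm_apply_sub_le (hxΩ τ (hsub hτ)) (hsub t.2) (hsub s.2) _
  · obtain ⟨E, hE⟩ := hA.exists_finset_norm_apply_sub_sub_add_le hx hxΩ hz hε
    exact ⟨E, fun u hu v hv huv s hs t ht =>
      hE u (hsub hu) v (hsub hv) huv s (hsub hs) t (hsub ht)⟩

end KurzweilClass

theorem xor_existsUnique_sub_eq_of_isCompactOperator {𝕜 E : Type*} [NontriviallyNormedField 𝕜]
    [NormedAddCommGroup E] [NormedSpace 𝕜 E] [CompleteSpace E] {K : E →L[𝕜] E}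
    (hK : IsCompactOperator K) : Xor (∀ q, ∃! z, z - K z = q) (∃ z ≠ 0, z - K z = 0) := by
  by_cases hker : ∃ z ≠ 0, z - K z = 0
  · refine Or.inr ⟨hker, fun hq => ?_⟩
    obtain ⟨z, hz, hKz⟩ := hker
    exact hz ((hq 0).unique hKz (by simp))
  · refine Or.inl ⟨?_, hker⟩
    rcases hK.hasEigenvalue_or_mem_resolventSet one_ne_zero with h | h
    · obtain ⟨z, hz⟩ := h.exists_hasEigenvector
      have hKz : K z = z := by simpa using hz.apply_eq_smul
      exact absurd ⟨z, hz.2, by rw [hKz, sub_self]⟩ hker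
    · rw [spectrum.mem_resolventSet_iff, ContinuousLinearMap.isUnit_iff_bijective] at h
      intro q
      simpa [Algebra.algebraMap_eq_smul_one] using h.existsUnique q

theorem mainTheorem7_general {a b : ℝ} (hab : a ≤ b) {Z X : Type*} [NormedAddCommGroup Z]
    [NormedAddCommGroup X] [NormedSpace ℝ X] [FiniteDimensional ℝ X] {Ω : Set Z} {h ω : ℝ → ℝ}
    {A : Z → ℝ → X →L[ℝ] X} (hA : KurzweilClass Ω a b h ω A) {x : ℝ → Z}
    (hx : IsRegulated fun t : Icc a b => x t) (hxΩ : ∀ t ∈ Icc a b, x t ∈ Ω) :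
    Xor (∀ q : RegulatedSpace a b X, ∃! z : RegulatedSpace a b X, ∀ s ∈ Icc a b, ∃ J,
        HasKurzweilIntegral (fun τ t => A (x τ) t (z.eval τ)) a s J ∧
          z.eval s - z.eval b - J = q.eval s)
      (∃ z : RegulatedSpace a b X, z ≠ 0 ∧ ∀ s ∈ Icc a b, ∃ J,
        HasKurzweilIntegral (fun τ t => A (x τ) t (z.eval τ)) a s J ∧
          z.eval s - z.eval b - J = (0 : RegulatedSpace a b X).eval s) ∧
    ∃ K : RegulatedSpace a b X →L[ℝ] RegulatedSpace a b X, IsCompactOperator K ∧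
      ∀ z : RegulatedSpace a b X, ∀ s ∈ Icc a b,
        HasKurzweilIntegral (fun τ t => A (x τ) t (z.eval τ)) a s
          ((K z).eval s - z.eval b) := by
  let U : RegulatedSpace a b X →ₗ[ℝ] ℝ → ℝ → X :=
    { toFun := fun z τ t => A (x τ) t (z.eval τ)
      map_add' := fun y z => by simp only [RegulatedSpace.eval_add, map_add]; rfl
      map_smul' := fun r z => by simp only [RegulatedSpace.eval_smul, map_smul]; rfl }
  have : ProperSpace X := FiniteDimensional.proper_real X
  have hU : ∀ z, ∀ τ ∈ Icc a b, ∀ s ∈ Icc a b, ∀ t ∈ Icc a b,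
      ‖U z τ t - U z τ s‖ ≤ ‖z‖ * |h t - h s| := fun z τ hτ s hs t ht =>
    (hA.norm_apply_sub_le (hxΩ τ hτ) hs ht _).trans
      (mul_le_mul_of_nonneg_right (z.norm_eval_le τ) (abs_nonneg _))
  obtain ⟨K, hK, hKprim⟩ := exists_isCompactOperator_isKurzweilPrimitive hab hA.h_mono U
    (RegulatedSpace.evalCLM b) hU
    fun z s hs => hA.exists_hasKurzweilIntegral hx hxΩ z.isRegulated_eval hs
  have hiff := fun z => (hKprim z).forall_exists_sub_eq_iff z
  refine ⟨?_, K, hK, hKprim⟩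
  have hfredholm := xor_existsUnique_sub_eq_of_isCompactOperator hK
  simp only [← hiff] at hfredholm
  exact hfredholm

theorem mainTheorem7 {n : ℕ} {T : ℝ} (hT : 0 < T)
    (Λ : Set ℝ) (hΛ : IsOpen Λ) (Ω : Set (RVec n)) (hΩ : IsOpen Ω)
    (F : ℝ → RVec n → ℝ → RVec n)
    (hF : ∃ h ω : ℝ → ℝ, ∀ lam ∈ Λ, KurzweilClass Ω 0 T h ω (F lam))
    (x₀ : RegulatedSpace 0 T (RVec n))
    (hx₀ : ∀ lam ∈ Λ, IsPeriodicSolution Ω (F lam) x₀)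
    (hρ : ∃ ρ > 0, ∀ x ∈ Metric.closedBall x₀ ρ, ∀ t ∈ Set.Icc 0 T, x.eval t ∈ Ω)
    (F' : ℝ → RVec n → ℝ → (RVec n →L[ℝ] RVec n))
    (hF' : ∀ lam ∈ Λ, ∀ x ∈ Ω, ∀ t ∈ Set.Icc 0 T,
      HasFDerivAt (fun y => F lam y t) (F' lam x t) x)
    (hF'cont : ∀ lam ∈ Λ, ∀ t ∈ Set.Icc 0 T, ContinuousOn (fun x => F' lam x t) Ω)
    (hF'class : ∃ h ω : ℝ → ℝ, ∀ lam ∈ Λ, KurzweilClass Ω 0 T h ω (F' lam))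
    (lam₀ : ℝ) (hlam₀ : lam₀ ∈ Λ) :
    Xor (∀ q : RegulatedSpace 0 T (RVec n), ∃! z : RegulatedSpace 0 T (RVec n),
        SolvesLinearized (F' lam₀) x₀ z q)
      (∃ z : RegulatedSpace 0 T (RVec n), z ≠ 0 ∧ SolvesLinearized (F' lam₀) x₀ z 0) ∧
    ∃ K : RegulatedSpace 0 T (RVec n) →L[ℝ] RegulatedSpace 0 T (RVec n),
      IsCompactOperator K ∧
      ∀ z : RegulatedSpace 0 T (RVec n), ∀ s ∈ Set.Icc 0 T,
        HasKurzweilIntegral (fun τ t => F' lam₀ (x₀.eval τ) t (z.eval τ)) 0 s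
          ((K z).eval s - z.eval T) := by
  obtain ⟨h, ω, hclass⟩ := hF'class
  exact mainTheorem7_general hT.le (hclass lam₀ hlam₀) x₀.isRegulated_eval
    fun s hs => ((hx₀ lam₀ hlam₀).1 s hs).1
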